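/- **Theorem (Semi-completeness, Kunen semantics).** *Setting.* Fix a first-order language with at least one constant. A query is a finite sequence of literals (a conjunction), a normal program $P$ is a finite set of clauses $H\gets\vec B$ with $H$ an atom and $\vec B$ a query, and a specification is a pair $(\mathit{Snf},\mathit{St})$ of Herbrand interpretations (sets of ground atoms). For each predicate symbol $p$ let $p'$ be a new one. $I'$ is $I$ with each $p$ replaced by $p'$; $Q'$ (respectively $Q''$) is the query $Q$ with $p$ replaced by $p'$ in the negative (respectively positive) literals. $\mathit{St}\cup\mathit{Snf}'\models Q'$ and $\mathit{St}\cup\mathit{Snf}'\models\neg Q'$ (and similarly for $Q''$) mean two-valued truth for all valuations of the variables by ground terms. $comp(P)\models_3 Q$ (respectively $\neg Q$) means that $Q$ is true (respectively false) under all valuations in all 3-valued (Kleene) models of Clark's completion of $P$, with the free equality axioms for all function symbols of the language, $=$ being interpreted as identity. $P$ is *correct under KS* w.r.t. $(\mathit{Snf},\mathit{St})$ if for every query $Q$: $comp(P)\models_3 Q$ implies $\mathit{St}\cup\mathit{Snf}'\models Q'$, and $comp(P)\models_3\neg Q$ implies $\mathit{St}\cup\mathit{Snf}'\models\neg Q''$.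 *SLDNF-resolution.* Fix any set of negative literals, called *dealt with*. In a *main SLDNF-tree* for $P$ and $Q$, the root is $Q$ and an arbitrary literal is selected in each non-empty node. A node with a positive literal selected has the children it has in an SLD-tree (one resolvent for each clause of $P$ whose renamed-apart head is unifiable with the selected atom), and is marked failed if there are none. If $\neg A$ is selected in $\vec A,\neg A,\vec B$, then either $\neg A$ is not dealt with and the node is a leaf marked floundered; or $\neg A$ is dealt with, $A$ succeeds with a most general answer (a variant of $A$) and the node is a leaf marked failed; or $\neg A$ is dealt with, $A$ finitely fails and the node has the single child $\vec A,\vec B$. A tree *finitely fails* if it is finite and all its leaves are marked failed; a query finitely fails if it has such a tree. The answer of a branch that ends with the empty query is $Q\theta$, with $\theta$ the composition of the mgu's along the branch; a query succeeds with the answers of such branches (successful derivations). Finite failure and success are defined simultaneously, as the least relations with these properties. A main tree is *non-diverging* if it is finite and has no floundered leaf. $P$ is *SLDNF-semi-complete for $Q$* w.r.t. $(\mathit{Snf},\mathit{St})$ if for every non-diverging main SLDNF-tree $T$ for $P$ and $Q$: (i) for each instance $Q\theta$ with $\mathit{St}\cup\mathit{Snf}'\models Q''\theta$, $T$ has an answer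 of which $Q\theta$ is an instance; (ii) if $\mathit{St}\cup\mathit{Snf}'\models\neg Q'$ then $T$ finitely fails. The language is *extended* for $P$ and $Q$ if it has infinitely many constants, or a non-constant function symbol occurring neither in $P$ nor in $Q$. *Claim.* Let $P$ be correct under KS w.r.t. $(\mathit{Snf},\mathit{St})$. Then: 1. $P$ is SLDNF-semi-complete w.r.t. $(\mathit{Snf},\mathit{St})$ for each query $Q$ for which the language is extended. 2. $P$ is semi-complete under KS for these queries: if such a $Q$ has a non-diverging main SLDNF-tree, then $\mathit{St}\cup\mathit{Snf}'\models Q''$ implies $comp(P)\models_3 Q$, and $\mathit{St}\cup\mathit{Snf}'\models\neg Q'$ implies $comp(P)\models_3\neg Q$. 3. Whether or not the language is extended, for each query $Q$ and each non-diverging main SLDNF-tree $T$ for $P$ and $Q$, (i) holds for all ground instances $Q\theta$ of $Q$, and (ii) holds. In particular $P$ is SLDNF-semi-complete for each ground query. -/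

import Mathlib

universe u v

namespace LP

/-! ### Syntax of normal programs

The function symbols (constants are those of arity 0) and the predicate symbols are those of a
first-order language `L`; the variables are the natural numbers. -/

/-- An atom `p(x₁, …, xₙ)` with predicate symbols from `R` and arguments from `X`.  With `X` the set
of terms these are the atoms of the language, with `X` the set of ground terms the ground atoms, and
with `X` the domain of an interpretation the atoms over that domain. -/
structure RAtom (R : ℕ → Type v) (X : Type u) where
  arity : ℕ
  rel : R arity
  args : Fin arity → X

/-- Apply a function to all arguments. -/
def RAtom.map {R : ℕ → Type v} {X : Type*} {Y : Type*} (f : X → Y) (a : RAtom R X) : RAtom R Y :=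
  ⟨a.arity, a.rel, fun i => f (a.args i)⟩

/-- Replace the predicate symbol. -/
def RAtom.mapRel {R R₁ : ℕ → Type v} {X : Type*} (g : ∀ n, R n → R₁ n) (a : RAtom R X) :
    RAtom R₁ X :=
  ⟨a.arity, g a.arity a.rel, a.args⟩

/-- A literal: an atom or a negated atom. -/
inductive Literal (X : Type u) where
  | pos (a : X)
  | neg (a : X)

/-- The atom of a literal. -/
def Literal.atom {X : Type u} : Literal X → X
  | .pos a => a
  | .neg a => a

/-- Apply a function to the atom of a literal. -/
def Literal.map {X : Type*} {Y : Type*} (f : X → Y) : Literal X → Literal Y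
  | .pos a => .pos (f a)
  | .neg a => .neg (f a)

/-- Substitutions. -/
abbrev Subst (L : FirstOrder.Language.{u, v}) := ℕ → L.Term ℕ

/-- Atoms with predicate symbols from `R`. -/
abbrev AtomOver (L : FirstOrder.Language.{u, v}) (R : ℕ → Type v) := RAtom R (L.Term ℕ)

/-- Queries (finite sequences of literals) with predicate symbols from `R`. -/
abbrev QueryOver (L : FirstOrder.Language.{u, v}) (R : ℕ → Type v) := List (Literal (AtomOver L R))

/-- Atoms of the language `L`. -/
abbrev Atom (L : FirstOrder.Language.{u, v}) := AtomOver L L.Relations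

/-- Queries of the language `L`. -/
abbrev Query (L : FirstOrder.Language.{u, v}) := QueryOver L L.Relations

/-- Application of a substitution to an atom. -/
def applyA {L : FirstOrder.Language.{u, v}} {R : ℕ → Type v} (θ : Subst L) (A : AtomOver L R) :
    AtomOver L R :=
  A.map (fun t => t.subst θ)

/-- Application of a substitution to a query. -/
def applyQ {L : FirstOrder.Language.{u, v}} {R : ℕ → Type v} (θ : Subst L) (Q : QueryOver L R) :
    QueryOver L R :=
  Q.map (Literal.map (applyA θ))

/-- Clauses `head ← body`. -/
structure Clause (L : FirstOrder.Language.{u, v}) where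
  head : Atom L
  body : Query L

/-- Application of a substitution to a clause. -/
def Clause.apply {L : FirstOrder.Language.{u, v}} (θ : Subst L) (C : Clause L) : Clause L :=
  ⟨applyA θ C.head, applyQ θ C.body⟩

/-- A normal program is a finite set of clauses. -/
abbrev Program (L : FirstOrder.Language.{u, v}) := Finset (Clause L)

/-- The variable `x` occurs in an atom. -/
def VarInAtom {L : FirstOrder.Language.{u, v}} (x : ℕ) (A : Atom L) : Prop :=
  ∃ i, x ∈ (A.args i).varFinset

/-- The variable `x` occurs in a query. -/
def VarInQuery {L : FirstOrder.Language.{u, v}} (x : ℕ) (Q : Query L) : Prop :=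
  ∃ l ∈ Q, VarInAtom x l.atom

/-- The variable `x` occurs in a clause. -/
def VarInClause {L : FirstOrder.Language.{u, v}} (x : ℕ) (C : Clause L) : Prop :=
  VarInAtom x C.head ∨ VarInQuery x C.body

/-- A query without variables. -/
def IsGround {L : FirstOrder.Language.{u, v}} (Q : Query L) : Prop := ∀ x, ¬ VarInQuery x Q

/-- The function symbol `f` occurs in a term. -/
def FunInTerm {L : FirstOrder.Language.{u, v}} {n : ℕ} (f : L.Functions n) : L.Term ℕ → Prop
  | .var _ => False
  | @FirstOrder.Language.Term.func _ _ m g ts =>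
      (⟨n, f⟩ : Σ k, L.Functions k) = ⟨m, g⟩ ∨ ∃ i, FunInTerm f (ts i)

/-- The function symbol `f` occurs in an atom. -/
def FunInAtom {L : FirstOrder.Language.{u, v}} {n : ℕ} (f : L.Functions n) (A : Atom L) : Prop :=
  ∃ i, FunInTerm f (A.args i)

/-- The function symbol `f` occurs in a query. -/
def FunInQuery {L : FirstOrder.Language.{u, v}} {n : ℕ} (f : L.Functions n) (Q : Query L) : Prop :=
  ∃ l ∈ Q, FunInAtom f l.atom

/-- The function symbol `f` occurs in a program. -/
def FunInProgram {L : FirstOrder.Language.{u, v}} {n : ℕ} (f : L.Functions n) (P : Program L) : Prop :=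
  ∃ C ∈ P, FunInAtom f C.head ∨ FunInQuery f C.body

/-- The language is extended for the program `P` and the query `Q`: it has infinitely many
constants, or a non-constant function symbol that occurs neither in `P` nor in `Q`. -/
def Extended {L : FirstOrder.Language.{u, v}} (P : Program L) (Q : Query L) : Prop :=
  Infinite (L.Functions 0) ∨
    ∃ (n : ℕ) (f : L.Functions n), 0 < n ∧ ¬ FunInProgram f P ∧ ¬ FunInQuery f Q

/-- The query `Q₁` is more general than the query `Q₂`. -/
def MoreGeneral {L : FirstOrder.Language.{u, v}} (Q₁ Q₂ : Query L) : Prop := ∃ δ : Subst L, Q₂ = applyQ δ Q₁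

/-- A renaming: a substitution that permutes the variables. -/
def permSubst {L : FirstOrder.Language.{u, v}} (π : Equiv.Perm ℕ) : Subst L := fun x => .var (π x)

/-- `Q₂` is a variant of `Q₁`. -/
def IsVariantQ {L : FirstOrder.Language.{u, v}} (Q₁ Q₂ : Query L) : Prop :=
  ∃ π : Equiv.Perm ℕ, Q₂ = applyQ (permSubst π) Q₁

/-- `C₂` is a variant of `C₁`. -/
def IsVariantC {L : FirstOrder.Language.{u, v}} (C₁ C₂ : Clause L) : Prop :=
  ∃ π : Equiv.Perm ℕ, C₂ = C₁.apply (permSubst π)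

/-- `θ` is a most general unifier of `A` and `B`. -/
def IsMGU {L : FirstOrder.Language.{u, v}} (θ : Subst L) (A B : Atom L) : Prop :=
  applyA θ A = applyA θ B ∧
    ∀ σ : Subst L, applyA σ A = applyA σ B → ∃ δ : Subst L, σ = fun x => (θ x).subst δ

/-! ### Specifications -/

/-- Ground atoms over the predicate symbols `R`; the elements of the Herbrand base. -/
abbrev GroundAtom (L : FirstOrder.Language.{u, v}) (R : ℕ → Type v) := RAtom R (L.Term Empty)

/-- Two-valued Herbrand interpretations. -/
abbrev Herbrand (L : FirstOrder.Language.{u, v}) (R : ℕ → Type v) := Set (GroundAtom L R)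

/-- A (two-valued) Herbrand interpretation makes a literal true under a valuation. -/
def HoldsLit {L : FirstOrder.Language.{u, v}} {R : ℕ → Type v} (I : Herbrand L R) (ν : ℕ → L.Term Empty) :
    Literal (AtomOver L R) → Prop
  | .pos A => A.map (fun t => t.subst ν) ∈ I
  | .neg A => A.map (fun t => t.subst ν) ∉ I

/-- `I ⊨ Q` (the query is a conjunction, its variables are universally quantified). -/
def Sat {L : FirstOrder.Language.{u, v}} {R : ℕ → Type v} (I : Herbrand L R) (Q : QueryOver L R) : Prop :=
  ∀ ν : ℕ → L.Term Empty, ∀ l ∈ Q, HoldsLit I ν l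

/-- `I ⊨ ¬Q` (again universally quantified). -/
def SatNot {L : FirstOrder.Language.{u, v}} {R : ℕ → Type v} (I : Herbrand L R) (Q : QueryOver L R) : Prop :=
  ∀ ν : ℕ → L.Term Empty, ¬ ∀ l ∈ Q, HoldsLit I ν l

/-- The alphabet with a new predicate symbol (`Sum.inr p`, the primed `p`) for each predicate
symbol `p` (`Sum.inl p`). -/
abbrev Doubled (R : ℕ → Type v) : ℕ → Type v := fun n => R n ⊕ R n

/-- An atom over the original alphabet, as an atom over the doubled one. -/
def plainA {R : ℕ → Type v} {X : Type*} (A : RAtom R X) : RAtom (Doubled R) X :=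
  A.mapRel (fun _ => Sum.inl)

/-- An atom with its predicate symbol primed. -/
def primedA {R : ℕ → Type v} {X : Type*} (A : RAtom R X) : RAtom (Doubled R) X :=
  A.mapRel (fun _ => Sum.inr)

/-- The query obtained by priming the predicate symbols of the negative literals. -/
def primeNeg {L : FirstOrder.Language.{u, v}} (Q : Query L) : QueryOver L (Doubled L.Relations) :=
  Q.map fun
    | .pos A => .pos (plainA A)
    | .neg A => .neg (primedA A)

/-- The query obtained by priming the predicate symbols of the positive literals. -/
def primePos {L : FirstOrder.Language.{u, v}} (Q : Query L) : QueryOver L (Doubled L.Relations) :=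
  Q.map fun
    | .pos A => .pos (primedA A)
    | .neg A => .neg (plainA A)

/-- An approximate specification: a pair of Herbrand interpretations. -/
structure Spec (L : FirstOrder.Language.{u, v}) where
  snf : Herbrand L L.Relations
  st : Herbrand L L.Relations

/-- The interpretation over the doubled alphabet which is the union of `st` and of the primed
version of `snf`. -/
def Spec.interp {L : FirstOrder.Language.{u, v}} (S : Spec L) : Herbrand L (Doubled L.Relations) :=
  plainA '' S.st ∪ primedA '' S.snf

/-! ### Three-valued completion semantics -/

/-- A three-valued interpretation with domain `M`: an atom over `M` is true, or false, or (if it is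
in neither set) undefined.  Equality is two-valued identity. -/
structure Interp3 (L : FirstOrder.Language.{u, v}) (M : Type*) where
  funMap : ∀ {n : ℕ}, L.Functions n → (Fin n → M) → M
  isTrue : Set (RAtom L.Relations M)
  isFalse : Set (RAtom L.Relations M)
  disj : Disjoint isTrue isFalse

/-- The value of a term. -/
def Interp3.val {L : FirstOrder.Language.{u, v}} {M : Type*} (I : Interp3 L M) (ν : ℕ → M) : L.Term ℕ → M
  | .var x => ν x
  | .func f ts => I.funMap f (fun i => I.val ν (ts i))

/-- The instance of an atom in the domain, under a valuation. -/
def Interp3.atomVal {L : FirstOrder.Language.{u, v}} {M : Type*} (I : Interp3 L M) (ν : ℕ → M) (A : Atom L) :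
    RAtom L.Relations M :=
  A.map (I.val ν)

/-- The literal has the truth value true. -/
def Interp3.LitTrue {L : FirstOrder.Language.{u, v}} {M : Type*} (I : Interp3 L M) (ν : ℕ → M) :
    Literal (Atom L) → Prop
  | .pos A => I.atomVal ν A ∈ I.isTrue
  | .neg A => I.atomVal ν A ∈ I.isFalse

/-- The literal has the truth value false. -/
def Interp3.LitFalse {L : FirstOrder.Language.{u, v}} {M : Type*} (I : Interp3 L M) (ν : ℕ → M) :
    Literal (Atom L) → Prop
  | .pos A => I.atomVal ν A ∈ I.isFalse
  | .neg A => I.atomVal ν A ∈ I.isTrue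

/-- The query (a conjunction, in Kleene logic) has the truth value true. -/
def Interp3.QTrue {L : FirstOrder.Language.{u, v}} {M : Type*} (I : Interp3 L M) (ν : ℕ → M)
    (Q : Query L) : Prop :=
  ∀ l ∈ Q, I.LitTrue ν l

/-- The query (a conjunction, in Kleene logic) has the truth value false. -/
def Interp3.QFalse {L : FirstOrder.Language.{u, v}} {M : Type*} (I : Interp3 L M) (ν : ℕ → M)
    (Q : Query L) : Prop :=
  ∃ l ∈ Q, I.LitFalse ν l

/-- Three-valued models of Clark's completion of `P`: models of the free equality axioms for all
function symbols of the language, in which, for each predicate symbol `p`, the completed definition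
`∀ x̄ (p(x̄) ↔ ⋁ ∃ ȳ (x̄ = t̄ ∧ body))` (a disjunction over the clauses `p(t̄) ← body` of `P` with
variables `ȳ`) holds; `↔` expresses that both sides have the same truth value, so that they are true
for the same arguments and false for the same arguments. -/
structure Interp3.IsModelComp {L : FirstOrder.Language.{u, v}} {M : Type*} (I : Interp3 L M)
    (P : Program L) : Prop where
  inj : ∀ {n : ℕ} (f : L.Functions n) (a b : Fin n → M), I.funMap f a = I.funMap f b → a = b
  distinct : ∀ {m n : ℕ} (f : L.Functions m) (g : L.Functions n) (a : Fin m → M) (b : Fin n → M),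
    (⟨m, f⟩ : Σ k, L.Functions k) ≠ ⟨n, g⟩ → I.funMap f a ≠ I.funMap g b
  acyclic : ∀ (t : L.Term ℕ) (x : ℕ) (ν : ℕ → M), x ∈ t.varFinset → t ≠ .var x → I.val ν t ≠ ν x
  compTrue : ∀ a : RAtom L.Relations M,
    a ∈ I.isTrue ↔ ∃ C ∈ P, ∃ ν : ℕ → M, I.atomVal ν C.head = a ∧ I.QTrue ν C.body
  compFalse : ∀ a : RAtom L.Relations M,
    a ∈ I.isFalse ↔ ∀ C ∈ P, ∀ ν : ℕ → M, I.atomVal ν C.head = a → I.QFalse ν C.body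

/-- `comp(P) ⊨₃ Q`. -/
def CompEntails {L : FirstOrder.Language.{u, v}} (P : Program L) (Q : Query L) : Prop :=
  ∀ (M : Type (max u v)) [Nonempty M] (I : Interp3 L M), I.IsModelComp P → ∀ ν : ℕ → M, I.QTrue ν Q

/-- `comp(P) ⊨₃ ¬Q`. -/
def CompEntailsNot {L : FirstOrder.Language.{u, v}} (P : Program L) (Q : Query L) : Prop :=
  ∀ (M : Type (max u v)) [Nonempty M] (I : Interp3 L M), I.IsModelComp P → ∀ ν : ℕ → M, I.QFalse ν Q

/-- Correctness of a program with respect to a specification, under Kunen semantics. -/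
def CorrectKS {L : FirstOrder.Language.{u, v}} (P : Program L) (S : Spec L) : Prop :=
  ∀ Q : Query L,
    (CompEntails P Q → Sat S.interp (primeNeg Q)) ∧
    (CompEntailsNot P Q → SatNot S.interp (primePos Q))

/-- Completeness for a query under Kunen semantics. -/
def CompleteKSFor {L : FirstOrder.Language.{u, v}} (P : Program L) (S : Spec L) (Q : Query L) : Prop :=
  (Sat S.interp (primePos Q) → CompEntails P Q) ∧
  (SatNot S.interp (primeNeg Q) → CompEntailsNot P Q)

/-! ### SLDNF-resolution -/

/-- Finite trees of the shape of main SLDNF-trees.  Each constructor is a kind of root: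
the empty query; a query `l, A, r` with the positive literal `A` selected, with a child for each
clause from the finite set `S` (`input` and `mgu` are the variant of the clause and the mgu used);
a query `l, ¬A, r` with `¬A` selected and with one child; such a query as a leaf marked failed; and
such a query as a leaf marked floundered. -/
inductive Tree (L : FirstOrder.Language.{u, v}) where
  | empty : Tree L
  | pos (l : Query L) (A : Atom L) (r : Query L) (S : Finset (Clause L))
      (input : {C // C ∈ S} → Clause L) (mgu : {C // C ∈ S} → Subst L)
      (child : {C // C ∈ S} → Tree L) : Tree L
  | neg (l : Query L) (A : Atom L) (r : Query L) (child : Tree L) : Tree L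
  | negFailed (l : Query L) (A : Atom L) (r : Query L) : Tree L
  | floundered (l : Query L) (A : Atom L) (r : Query L) : Tree L

/-- No leaf is empty or floundered, that is, all leaves are marked failed.  (A node with a positive
literal selected and without children is marked failed.) -/
def Tree.Failed {L : FirstOrder.Language.{u, v}} : Tree L → Prop
  | .empty => False
  | .pos _ _ _ _ _ _ child => ∀ C, (child C).Failed
  | .neg _ _ _ child => child.Failed
  | .negFailed _ _ _ => True
  | .floundered _ _ _ => False

/-- The tree flounders: some leaf is marked floundered. -/
def Tree.Flounders {L : FirstOrder.Language.{u, v}} : Tree L → Prop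
  | .empty => False
  | .pos _ _ _ _ _ _ child => ∃ C, (child C).Flounders
  | .neg _ _ _ child => child.Flounders
  | .negFailed _ _ _ => False
  | .floundered _ _ _ => True

/-- `T.answers W` is the set of the queries `W θ` where `θ` is the composition of the mgus along a
successful branch (one that ends with the empty query) of `T`. -/
def Tree.answers {L : FirstOrder.Language.{u, v}} : Tree L → Query L → Set (Query L)
  | .empty, W => {W}
  | .pos _ _ _ _ _ mgu child, W => {X | ∃ C, X ∈ (child C).answers (applyQ (mgu C) W)}
  | .neg _ _ _ child, W => child.answers W
  | .negFailed _ _ _, _ => ∅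
  | .floundered _ _ _, _ => ∅

/-- `C₁` is a variant of `C` that is standardized apart: it has no variable in common with the
current query `G`, nor with the instance `W` of the initial query obtained so far. -/
def FreshVariant {L : FirstOrder.Language.{u, v}} (W G : Query L) (C C₁ : Clause L) : Prop :=
  IsVariantC C C₁ ∧ ∀ x, VarInClause x C₁ → ¬ VarInQuery x W ∧ ¬ VarInQuery x G

/-- The head of (a variant with new variables of) `C` is unifiable with `A`. -/
def HeadUnifiable {L : FirstOrder.Language.{u, v}} (A : Atom L) (C : Clause L) : Prop :=
  ∃ σ τ : Subst L, applyA σ A = applyA τ C.head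

mutual

/-- `MainSubtree P D W G T`: `T` is a finite SLDNF-tree with root `G` for the program `P`, where `D`
tells for which atoms `A` the literal `¬A` is dealt with, and where `W` is the instance of the
initial query obtained so far (by the mgus on the path that leads to `G`). The selection of a
literal in each node is arbitrary. -/
inductive MainSubtree {L : FirstOrder.Language.{u, v}} (P : Program L) (D : Atom L → Prop) :
    Query L → Query L → Tree L → Prop
  | empty (W : Query L) : MainSubtree P D W [] .empty
  | pos (W l : Query L) (A : Atom L) (r : Query L) (S : Finset (Clause L))
      (input : {C // C ∈ S} → Clause L) (mgu : {C // C ∈ S} → Subst L)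
      (child : {C // C ∈ S} → Tree L)
      (hS : ∀ C, C ∈ S ↔ C ∈ P ∧ HeadUnifiable A C)
      (hinput : ∀ C, FreshVariant W (l ++ .pos A :: r) C.1 (input C))
      (hmgu : ∀ C, IsMGU (mgu C) A (input C).head)
      (hchild : ∀ C, MainSubtree P D (applyQ (mgu C) W)
        (applyQ (mgu C) (l ++ (input C).body ++ r)) (child C)) :
      MainSubtree P D W (l ++ .pos A :: r) (.pos l A r S input mgu child)
  | neg (W l : Query L) (A : Atom L) (r : Query L) (child : Tree L)
      (hD : D A) (hfail : FinitelyFails P D [.pos A]) (hchild : MainSubtree P D W (l ++ r) child) :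
      MainSubtree P D W (l ++ .neg A :: r) (.neg l A r child)
  | negFailed (W l : Query L) (A : Atom L) (r : Query L)
      (hD : D A) (X : Query L) (hX : IsVariantQ [.pos A] X)
      (hsucc : Refutes P D [.pos A] [.pos A] X) :
      MainSubtree P D W (l ++ .neg A :: r) (.negFailed l A r)
  | floundered (W l : Query L) (A : Atom L) (r : Query L) (hD : ¬ D A) :
      MainSubtree P D W (l ++ .neg A :: r) (.floundered l A r)

/-- The query `Q` finitely fails: it has a finite main SLDNF-tree with all leaves failed. -/
inductive FinitelyFails {L : FirstOrder.Language.{u, v}} (P : Program L) (D : Atom L → Prop) :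
    Query L → Prop
  | intro (Q : Query L) (T : Tree L) (hT : MainSubtree P D Q Q T) (hfailed : T.Failed) :
      FinitelyFails P D Q

/-- `Refutes P D W G X`: there is a successful SLDNF-derivation from `G` such that `X` is the query
`W θ`, where `θ` is the composition of the mgus along the derivation.  So `Refutes P D Q Q X` means
that `Q` succeeds with the computed answer `X`.  Such a derivation is a successful branch of a main
SLDNF-tree, which need not be finite. -/
inductive Refutes {L : FirstOrder.Language.{u, v}} (P : Program L) (D : Atom L → Prop) :
    Query L → Query L → Query L → Prop
  | empty (W : Query L) : Refutes P D W [] W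
  | pos (W l : Query L) (A : Atom L) (r : Query L) (C C₁ : Clause L) (θ : Subst L) (X : Query L)
      (hC : C ∈ P) (hinput : FreshVariant W (l ++ .pos A :: r) C C₁) (hmgu : IsMGU θ A C₁.head)
      (hrest : Refutes P D (applyQ θ W) (applyQ θ (l ++ C₁.body ++ r)) X) :
      Refutes P D W (l ++ .pos A :: r) X
  | neg (W l : Query L) (A : Atom L) (r : Query L) (X : Query L)
      (hD : D A) (hfail : FinitelyFails P D [.pos A]) (hrest : Refutes P D W (l ++ r) X) :
      Refutes P D W (l ++ .neg A :: r) X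

end

/-- `T` is a finite main SLDNF-tree for `P` and `Q`. -/
def IsMainTree {L : FirstOrder.Language.{u, v}} (P : Program L) (D : Atom L → Prop) (Q : Query L)
    (T : Tree L) : Prop :=
  MainSubtree P D Q Q T

/-- `T` is a non-diverging (that is, finite and without floundered leaves) main SLDNF-tree for `P`
and `Q`.  Elements of `Tree L` are finite. -/
def NonDivergingTree {L : FirstOrder.Language.{u, v}} (P : Program L) (D : Atom L → Prop) (Q : Query L)
    (T : Tree L) : Prop :=
  IsMainTree P D Q T ∧ ¬ T.Flounders

/-- SLDNF-semi-completeness for a query. -/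
def SLDNFSemiCompleteFor {L : FirstOrder.Language.{u, v}} (P : Program L) (D : Atom L → Prop) (S : Spec L)
    (Q : Query L) : Prop :=
  ∀ T : Tree L, NonDivergingTree P D Q T →
    (∀ θ : Subst L, Sat S.interp (applyQ θ (primePos Q)) →
      ∃ X ∈ T.answers Q, MoreGeneral X (applyQ θ Q)) ∧
    (SatNot S.interp (primeNeg Q) → T.Failed)

/-- SLDNF-semi-completeness for a query, with only ground instances of the query considered. -/
def GroundSLDNFSemiCompleteFor {L : FirstOrder.Language.{u, v}} (P : Program L) (D : Atom L → Prop)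
    (S : Spec L) (Q : Query L) : Prop :=
  ∀ T : Tree L, NonDivergingTree P D Q T →
    (∀ θ : Subst L, IsGround (applyQ θ Q) → Sat S.interp (applyQ θ (primePos Q)) →
      ∃ X ∈ T.answers Q, MoreGeneral X (applyQ θ Q)) ∧
    (SatNot S.interp (primeNeg Q) → T.Failed)

/-- The condition for a query in the definition of semi-completeness under Kunen semantics:
completeness for the query, if the query has a non-diverging main SLDNF-tree. -/
def SemiCompleteKSFor {L : FirstOrder.Language.{u, v}} (P : Program L) (D : Atom L → Prop) (S : Spec L)
    (Q : Query L) : Prop :=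
  (∃ T : Tree L, NonDivergingTree P D Q T) → CompleteKSFor P S Q

end LP

-- The link between trees and models is `MainSubtree.sound`. It says two things about a finite main
-- tree `T` for `Q`. Every answer of `T` is a consequence of the completion. Conversely, in every
-- model, each valuation under which `Q` is not false factors, on the variables of `Q`, through an
-- answer of `T`, unless `T` flounders. The second half rests on unification in models of the free
-- equality axioms: a valuation that identifies two atoms factors through each of their mgus
-- (`exists_valuation_of_isMGU`).
--
-- Correctness of `P` carries this over to the specification. If a ground instance `Qθ` were an
-- instance of no answer, then by coverage and matching (`exists_matching`) it would be false in
-- every model, so the specification would refute `Q''θ`. If `T` is not failed, it has an answer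
-- `Qδ`; the completion entails it, so the specification satisfies `Q'δ` and cannot satisfy `¬Q'`.
--
-- An arbitrary instance `Qθ` is reduced to a ground one by a grounding `σ` of its variables. In an
-- extended language the terms `σ y` can be chosen so that, once `Qθσ` is known to be an instance of
-- an answer, each `σ y` can be turned back into the variable `y` (`exists_grounding`,
-- `exists_generalization`). This yields `Qθ` itself as an instance of that answer.

namespace LP

open FirstOrder.Language

variable {L : FirstOrder.Language.{u, v}}

/-! ### Substitutions and values of terms -/

theorem mem_varFinset_func {n x : ℕ} (f : L.Functions n) (ts : Fin n → L.Term ℕ) :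
    x ∈ (Term.func f ts).varFinset ↔ ∃ i, x ∈ (ts i).varFinset := by
  simp [Term.varFinset]

theorem mem_varFinset_var {x y : ℕ} : x ∈ (Term.var y : L.Term ℕ).varFinset ↔ x = y := by
  simp [Term.varFinset]

theorem subst_congr {β : Type*} (t : L.Term ℕ) {σ τ : ℕ → L.Term β}
    (h : ∀ x ∈ t.varFinset, σ x = τ x) : t.subst σ = t.subst τ := by
  induction t with
  | var x => exact h x (mem_varFinset_var.2 rfl)
  | func f ts ih =>
    simp only [Term.subst]
    congr 1
    funext i
    exact ih i fun x hx => h x ((mem_varFinset_func f ts).2 ⟨i, hx⟩)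

theorem subst_subst {β : Type*} (t : L.Term ℕ) (σ : Subst L) (τ : ℕ → L.Term β) :
    (t.subst σ).subst τ = t.subst fun x => (σ x).subst τ := by
  induction t with
  | var x => rfl
  | func f ts ih => simp only [Term.subst, ih]

theorem subst_var (t : L.Term ℕ) : t.subst Term.var = t := by
  induction t with
  | var x => rfl
  | func f ts ih => simp only [Term.subst, ih]

theorem mem_varFinset_subst {y : ℕ} (t : L.Term ℕ) (σ : Subst L) :
    y ∈ (t.subst σ).varFinset ↔ ∃ x ∈ t.varFinset, y ∈ (σ x).varFinset := by
  induction t with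
  | var x => simp [Term.subst, Term.varFinset]
  | func f ts ih =>
    simp only [Term.subst, mem_varFinset_func, ih]
    exact ⟨fun ⟨i, x, hx, hy⟩ => ⟨x, ⟨i, hx⟩, hy⟩, fun ⟨x, ⟨i, hx⟩, hy⟩ => ⟨i, x, hx, hy⟩⟩

theorem RAtom.map_eq_iff {R : ℕ → Type*} {X Y : Type*} (f g : X → Y) (A : RAtom R X) :
    A.map f = A.map g ↔ ∀ i, f (A.args i) = g (A.args i) := by
  cases A
  simp [RAtom.map, funext_iff]

theorem RAtom.map_map {R : ℕ → Type*} {X Y Z : Type*} (f : X → Y) (g : Y → Z) (A : RAtom R X) :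
    (A.map f).map g = A.map fun x => g (f x) := rfl

/-- Equations between images of atoms transfer along any map that respects the equations between
their arguments. -/
theorem RAtom.map_eq_map_of {R : ℕ → Type*} {X Y Z : Type*} {f : X → Y} {g : X → Z}
    {A B : RAtom R X} (h : ∀ i j, f (A.args i) = f (B.args j) → g (A.args i) = g (B.args j))
    (hAB : A.map f = B.map f) : A.map g = B.map g := by
  obtain ⟨n, p, s⟩ := A
  obtain ⟨m, q, t⟩ := B
  simp only [RAtom.map, RAtom.mk.injEq] at hAB
  obtain ⟨rfl, hpq, hst⟩ := hAB
  obtain rfl := eq_of_heq hpq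
  have hst := congrFun (eq_of_heq hst)
  simp only [RAtom.map, RAtom.mk.injEq, heq_eq_eq, true_and]
  funext i
  exact h i i (hst i)

theorem applyA_applyA {R : ℕ → Type v} (σ τ : Subst L) (A : AtomOver L R) :
    applyA τ (applyA σ A) = applyA (fun x => (σ x).subst τ) A := by
  simp only [applyA, RAtom.map_map, subst_subst]

theorem applyQ_applyQ {R : ℕ → Type v} (σ τ : Subst L) (Q : QueryOver L R) :
    applyQ τ (applyQ σ Q) = applyQ (fun x => (σ x).subst τ) Q := by
  simp only [applyQ, List.map_map]
  refine List.map_congr_left fun l _ => ?_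
  cases l <;> simp [Literal.map, applyA_applyA]

theorem applyQ_var (Q : Query L) : applyQ Term.var Q = Q := by
  refine (List.map_congr_left fun l _ => ?_).trans (List.map_id _)
  cases l <;> simp [Literal.map, applyA, RAtom.map, subst_var]

theorem applyA_congr {σ τ : Subst L} {A : Atom L} (h : ∀ x, VarInAtom x A → σ x = τ x) :
    applyA σ A = applyA τ A :=
  (RAtom.map_eq_iff _ _ A).2 fun i => subst_congr _ fun x hx => h x ⟨i, hx⟩

theorem applyQ_congr {σ τ : Subst L} {Q : Query L} (h : ∀ x, VarInQuery x Q → σ x = τ x) :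
    applyQ σ Q = applyQ τ Q := by
  refine List.map_congr_left fun l hl => ?_
  have h' := applyA_congr (A := l.atom) fun x hx => h x ⟨l, hl, hx⟩
  cases l <;> exact congrArg _ h'

theorem Literal.atom_map {X Y : Type*} (f : X → Y) (l : Literal X) :
    (l.map f).atom = f l.atom := by
  cases l <;> rfl

theorem varInQuery_applyQ {y : ℕ} {σ : Subst L} {Q : Query L} :
    VarInQuery y (applyQ σ Q) ↔ ∃ x, VarInQuery x Q ∧ y ∈ (σ x).varFinset := by
  constructor
  · rintro ⟨l, hl, i, hi⟩
    obtain ⟨k, hk, rfl⟩ := List.mem_map.1 hl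
    cases k with
    | pos A =>
      obtain ⟨x, hx, hy⟩ := (mem_varFinset_subst _ _).1 hi
      exact ⟨x, ⟨_, hk, i, hx⟩, hy⟩
    | neg A =>
      obtain ⟨x, hx, hy⟩ := (mem_varFinset_subst _ _).1 hi
      exact ⟨x, ⟨_, hk, i, hx⟩, hy⟩
  · rintro ⟨x, ⟨l, hl, i, hi⟩, hy⟩
    refine ⟨_, List.mem_map_of_mem hl, ?_⟩
    rw [Literal.atom_map]
    exact ⟨i, (mem_varFinset_subst _ _).2 ⟨x, hi, hy⟩⟩

namespace Interp3

variable {M : Type*} (I : Interp3 L M)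

theorem val_congr (t : L.Term ℕ) {ν μ : ℕ → M} (h : ∀ x ∈ t.varFinset, ν x = μ x) :
    I.val ν t = I.val μ t := by
  induction t with
  | var x => exact h x (mem_varFinset_var.2 rfl)
  | func f ts ih =>
    simp only [Interp3.val]
    congr 1
    funext i
    exact ih i fun x hx => h x ((mem_varFinset_func f ts).2 ⟨i, hx⟩)

theorem val_subst (ν : ℕ → M) (σ : Subst L) (t : L.Term ℕ) :
    I.val ν (t.subst σ) = I.val (fun x => I.val ν (σ x)) t := by
  induction t with
  | var x => rfl
  | func f ts ih => simp only [Term.subst, Interp3.val, ih]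

theorem atomVal_applyA (ν : ℕ → M) (σ : Subst L) (A : Atom L) :
    I.atomVal ν (applyA σ A) = I.atomVal (fun x => I.val ν (σ x)) A := by
  simp only [atomVal, applyA, RAtom.map_map, val_subst]

theorem atomVal_congr {A : Atom L} {ν μ : ℕ → M} (h : ∀ x, VarInAtom x A → ν x = μ x) :
    I.atomVal ν A = I.atomVal μ A :=
  (RAtom.map_eq_iff _ _ A).2 fun i => I.val_congr _ fun x hx => h x ⟨i, hx⟩

theorem qTrue_applyQ (ν : ℕ → M) (σ : Subst L) (Q : Query L) :
    I.QTrue ν (applyQ σ Q) ↔ I.QTrue (fun x => I.val ν (σ x)) Q := by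
  simp only [QTrue, applyQ, List.forall_mem_map]
  refine forall₂_congr fun l _ => ?_
  cases l <;> simp [LitTrue, Literal.map, atomVal_applyA]

theorem qFalse_applyQ (ν : ℕ → M) (σ : Subst L) (Q : Query L) :
    I.QFalse ν (applyQ σ Q) ↔ I.QFalse (fun x => I.val ν (σ x)) Q := by
  simp only [QFalse, applyQ, List.mem_map, exists_exists_and_eq_and]
  refine exists_congr fun l => and_congr_right fun _ => ?_
  cases l <;> simp [LitFalse, Literal.map, atomVal_applyA]

theorem qFalse_congr {Q : Query L} {ν μ : ℕ → M} (h : ∀ x, VarInQuery x Q → ν x = μ x) :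
    I.QFalse ν Q ↔ I.QFalse μ Q := by
  refine exists_congr fun l => and_congr_right fun hl => ?_
  have h' := I.atomVal_congr (A := l.atom) fun x hx => h x ⟨l, hl, hx⟩
  cases l <;> simp only [LitFalse, Literal.atom] at h' ⊢ <;> rw [h']

theorem qTrue_append (ν : ℕ → M) (Q₁ Q₂ : Query L) :
    I.QTrue ν (Q₁ ++ Q₂) ↔ I.QTrue ν Q₁ ∧ I.QTrue ν Q₂ := by
  simp only [QTrue, List.mem_append, or_imp, forall_and]

theorem qFalse_append (ν : ℕ → M) (Q₁ Q₂ : Query L) :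
    I.QFalse ν (Q₁ ++ Q₂) ↔ I.QFalse ν Q₁ ∨ I.QFalse ν Q₂ := by
  simp only [QFalse, List.mem_append, or_and_right, exists_or]

theorem qTrue_cons (ν : ℕ → M) (l : Literal (Atom L)) (Q : Query L) :
    I.QTrue ν (l :: Q) ↔ I.LitTrue ν l ∧ I.QTrue ν Q := by
  simp [QTrue]

theorem qFalse_cons (ν : ℕ → M) (l : Literal (Atom L)) (Q : Query L) :
    I.QFalse ν (l :: Q) ↔ I.LitFalse ν l ∨ I.QFalse ν Q := by
  simp [QFalse]

end Interp3

/-! ### Unification in models of the free equality axioms -/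

namespace Interp3.IsModelComp

variable {M : Type*} {I : Interp3 L M} {P : Program L}

theorem func_eq (hI : I.IsModelComp P) {m n : ℕ} {f : L.Functions m} {g : L.Functions n}
    {a : Fin m → M} {b : Fin n → M} (h : I.funMap f a = I.funMap g b) :
    (⟨m, f⟩ : Σ k, L.Functions k) = ⟨n, g⟩ := by
  by_contra hne
  exact hI.distinct f g a b hne h

/-- If the value of no variable in `V` is the value of a term over the other variables in `V`, then
only identical terms over `V` have the same value. -/
theorem eq_of_val_eq (hI : I.IsModelComp P) {V : Finset ℕ} {μ : ℕ → M}
    (hmin : ∀ (x : ℕ) (t : L.Term ℕ), x ∈ V → t.varFinset ⊆ V → x ∉ t.varFinset →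
      I.val μ t ≠ μ x) (s t : L.Term ℕ) (hs : s.varFinset ⊆ V) (ht : t.varFinset ⊆ V)
    (h : I.val μ s = I.val μ t) : s = t := by
  -- A term with the value of `x` is excluded by acyclicity if it properly contains `x`, and by
  -- `hmin` if `x` does not occur in it.
  have key : ∀ (x : ℕ) (t : L.Term ℕ), x ∈ V → t.varFinset ⊆ V → I.val μ t = μ x →
      t = .var x := by
    intro x t hx ht h
    by_contra hne
    by_cases hxt : x ∈ t.varFinset
    · exact hI.acyclic t x μ hxt hne h
    · exact hmin x t hx ht hxt h
  induction s generalizing t with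
  | var x => exact (key x t (hs (mem_varFinset_var.2 rfl)) ht h.symm).symm
  | func f ts ih =>
    cases t with
    | var y => exact key y _ (ht (mem_varFinset_var.2 rfl)) hs h
    | func g us =>
      have hfg := hI.func_eq h
      cases hfg
      have := hI.inj f _ _ h
      congr 1
      funext i
      exact ih i (us i) (fun x hx => hs ((mem_varFinset_func _ _).2 ⟨i, hx⟩))
        (fun x hx => ht ((mem_varFinset_func _ _).2 ⟨i, hx⟩)) (congrFun this i)

/-- A valuation in a model of the free equality axioms factors through a substitution that unifies
all terms over a given finite set of variables that the valuation identifies. -/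
theorem exists_unifier (hI : I.IsModelComp P) (V : Finset ℕ) (ν : ℕ → M) :
    ∃ (σ : Subst L) (μ : ℕ → M), (∀ x, I.val μ (σ x) = ν x) ∧
      ∀ s t : L.Term ℕ, s.varFinset ⊆ V → t.varFinset ⊆ V → I.val ν s = I.val ν t →
        s.subst σ = t.subst σ := by
  -- Among all factorizations of `ν`, one with the fewest variables in the images of `V` is taken;
  -- this minimality replaces a unification algorithm.
  let W : Subst L → Finset ℕ := fun σ => V.biUnion fun x => (σ x).varFinset
  have hW : ∀ (σ : Subst L) (s : L.Term ℕ), s.varFinset ⊆ V → (s.subst σ).varFinset ⊆ W σ := by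
    intro σ s hs y hy
    obtain ⟨x, hx, hy⟩ := (mem_varFinset_subst _ _).1 hy
    exact Finset.mem_biUnion.2 ⟨x, hs hx, hy⟩
  let p : ℕ → Prop := fun k => ∃ (σ : Subst L) (μ : ℕ → M),
    (∀ x, I.val μ (σ x) = ν x) ∧ (W σ).card = k
  have hp : ∃ k, p k := ⟨_, Term.var, ν, fun _ => rfl, rfl⟩
  classical
  obtain ⟨σ, μ, hσ, hcard⟩ := Nat.find_spec hp
  refine ⟨σ, μ, hσ, fun s t hs ht h => ?_⟩
  refine hI.eq_of_val_eq (V := W σ) (μ := μ) ?_ _ _ (hW σ s hs) (hW σ t ht) ?_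
  -- If `x` had the value of a term `u` over the other variables, replacing `x` by `u` would keep
  -- the factorization and eliminate `x`.
  · intro x u hx hu hxu hval
    let τ : Subst L := Function.update Term.var x u
    have hτ : ∀ y, I.val μ (τ y) = μ y := by
      intro y
      by_cases hy : y = x
      · subst hy; simpa [τ] using hval
      · simp [τ, hy, Interp3.val]
    have hlt : (W fun y => (σ y).subst τ).card < (W σ).card := by
      refine Finset.card_lt_card ⟨?_, ?_⟩
      · intro z hz
        obtain ⟨y, hy, hz⟩ := Finset.mem_biUnion.1 hz
        obtain ⟨w, hw, hz⟩ := (mem_varFinset_subst _ _).1 hz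
        by_cases hwx : w = x
        · subst hwx; exact hu (by simpa [τ] using hz)
        · simp only [τ, Function.update_of_ne hwx, mem_varFinset_var] at hz
          exact Finset.mem_biUnion.2 ⟨y, hy, hz ▸ hw⟩
      · intro hsub
        obtain ⟨y, hy, hz⟩ := Finset.mem_biUnion.1 (hsub hx)
        obtain ⟨w, hw, hz⟩ := (mem_varFinset_subst _ _).1 hz
        by_cases hwx : w = x
        · subst hwx; exact hxu (by simpa [τ] using hz)
        · simp only [τ, Function.update_of_ne hwx, mem_varFinset_var] at hz
          exact hwx hz.symm
    refine Nat.find_min hp (hcard ▸ hlt) ⟨_, μ, fun y => ?_, rfl⟩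
    simp only [Interp3.val_subst, hτ, hσ]
  · simpa only [Interp3.val_subst, hσ] using h

/-- A valuation that identifies two atoms factors through each of their most general unifiers. -/
theorem exists_valuation_of_isMGU (hI : I.IsModelComp P) {A B : Atom L} {θ : Subst L}
    (hθ : IsMGU θ A B) {ν : ℕ → M} (h : I.atomVal ν A = I.atomVal ν B) :
    ∃ μ : ℕ → M, ∀ x, I.val μ (θ x) = ν x := by
  obtain ⟨σ, μ, hσ, hunif⟩ := hI.exists_unifier
    (Finset.univ.biUnion (fun i => (A.args i).varFinset) ∪
      Finset.univ.biUnion (fun i => (B.args i).varFinset)) ν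
  -- The unifier read off from the model is an instance `θδ` of the mgu, so the valuation factors
  -- through `θ` as well.
  obtain ⟨δ, rfl⟩ := hθ.2 σ (RAtom.map_eq_map_of (fun i j => hunif _ _
    (fun x hx => Finset.mem_union_left _ (Finset.mem_biUnion.2 ⟨i, Finset.mem_univ _, hx⟩))
    (fun x hx => Finset.mem_union_right _ (Finset.mem_biUnion.2 ⟨j, Finset.mem_univ _, hx⟩))) h)
  exact ⟨fun x => I.val μ (δ x), fun x => by rw [← hσ x, Interp3.val_subst]⟩

/-- Atoms that are identified by a valuation are unifiable. -/
theorem exists_unifier_atom (hI : I.IsModelComp P) {A B : Atom L} {ν : ℕ → M}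
    (h : I.atomVal ν A = I.atomVal ν B) : ∃ σ : Subst L, applyA σ A = applyA σ B := by
  obtain ⟨σ, μ, hσ, hunif⟩ := hI.exists_unifier
    (Finset.univ.biUnion (fun i => (A.args i).varFinset) ∪
      Finset.univ.biUnion (fun i => (B.args i).varFinset)) ν
  exact ⟨σ, RAtom.map_eq_map_of (fun i j => hunif _ _
    (fun x hx => Finset.mem_union_left _ (Finset.mem_biUnion.2 ⟨i, Finset.mem_univ _, hx⟩))
    (fun x hx => Finset.mem_union_right _ (Finset.mem_biUnion.2 ⟨j, Finset.mem_univ _, hx⟩))) h⟩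

end Interp3.IsModelComp

/-! ### Soundness of SLDNF-resolution for the three-valued completion -/

namespace Interp3

variable {M : Type*} (I : Interp3 L M)

theorem qTrue_mid (ν : ℕ → M) (l r : Query L) (k : Literal (Atom L)) :
    I.QTrue ν (l ++ k :: r) ↔ I.LitTrue ν k ∧ I.QTrue ν (l ++ r) := by
  simp only [qTrue_append, qTrue_cons]
  tauto

theorem qFalse_mid (ν : ℕ → M) (l r : Query L) (k : Literal (Atom L)) :
    I.QFalse ν (l ++ k :: r) ↔ I.LitFalse ν k ∨ I.QFalse ν (l ++ r) := by
  simp only [qFalse_append, qFalse_cons]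
  tauto

end Interp3

namespace Interp3.IsModelComp

variable {M : Type*} {I : Interp3 L M} {P : Program L}

/-- If a resolvent is true then so is the query. -/
theorem qTrue_of_resolvent (hI : I.IsModelComp P) {C C₁ : Clause L} (hC : C ∈ P)
    (hvar : IsVariantC C C₁) {l r : Query L} {A : Atom L} {ν : ℕ → M}
    (hA : I.atomVal ν A = I.atomVal ν C₁.head) (h : I.QTrue ν (l ++ C₁.body ++ r)) :
    I.QTrue ν (l ++ .pos A :: r) := by
  obtain ⟨π, rfl⟩ := hvar
  simp only [Clause.apply, qTrue_append, qTrue_applyQ, atomVal_applyA] at h hA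
  refine (I.qTrue_mid _ _ _ _).2 ⟨?_, (I.qTrue_append _ _ _).2 ⟨h.1.1, h.2⟩⟩
  exact (hI.compTrue _).2 ⟨C, hC, _, hA.symm, h.1.2⟩

/-- An atom and the head of a clause that have the same value, each under some valuation, are
unifiable after standardizing apart. -/
theorem headUnifiable_of_atomVal_eq (hI : I.IsModelComp P) {A : Atom L} {C : Clause L}
    {ν ν₁ : ℕ → M} (h : I.atomVal ν A = I.atomVal ν₁ C.head) : HeadUnifiable A C := by
  -- Even variables for the atom and odd ones for the clause, so that one valuation `μ` can play the
  -- roles of both `ν` and `ν₁`.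
  let α : Subst L := fun x => .var (2 * x)
  let β : Subst L := fun x => .var (2 * x + 1)
  let μ : ℕ → M := fun x => if x % 2 = 0 then ν (x / 2) else ν₁ (x / 2)
  have hα : (fun x => I.val μ (α x)) = ν := by
    funext x
    simp [μ, α, Interp3.val]
  have hβ : (fun x => I.val μ (β x)) = ν₁ := by
    funext x
    have h₁ : (2 * x + 1) % 2 ≠ 0 := by omega
    have h₂ : (2 * x + 1) / 2 = x := by omega
    simp only [μ, β, Interp3.val, if_neg h₁, h₂]
  obtain ⟨σ, hσ⟩ := hI.exists_unifier_atom (A := applyA α A) (B := applyA β C.head) (ν := μ)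
    (by rw [atomVal_applyA, atomVal_applyA, hα, hβ, h])
  rw [applyA_applyA, applyA_applyA] at hσ
  exact ⟨_, _, hσ⟩

/-- If a query is not false under a valuation, then for some clause and each most general unifier
of the selected atom and the head of a variant of it that is standardized apart, the resolvent is
not false under a valuation through which the given one factors. -/
theorem exists_resolvent_not_qFalse (hI : I.IsModelComp P) {l r : Query L} {A : Atom L}
    {ν : ℕ → M} (h : ¬ I.QFalse ν (l ++ .pos A :: r)) :
    ∃ C ∈ P, HeadUnifiable A C ∧ ∀ (W : Query L) (C₁ : Clause L) (θ : Subst L),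
      FreshVariant W (l ++ .pos A :: r) C C₁ → IsMGU θ A C₁.head →
      ∃ μ : ℕ → M, (∀ x, VarInQuery x W → I.val μ (θ x) = ν x) ∧
        ¬ I.QFalse μ (applyQ θ (l ++ C₁.body ++ r)) := by
  have h' := h
  rw [qFalse_mid, not_or] at h'
  obtain ⟨hA, hlr⟩ := h'
  simp only [LitFalse, hI.compFalse, not_forall, exists_prop] at hA
  obtain ⟨C, hC, ν₁, hhead, hbody⟩ := hA
  have key : ∀ (W : Query L) (C₁ : Clause L), FreshVariant W (l ++ .pos A :: r) C C₁ →
      ∃ ν₂ : ℕ → M, (∀ x, VarInQuery x W ∨ VarInQuery x (l ++ .pos A :: r) → ν₂ x = ν x) ∧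
        I.atomVal ν₂ C₁.head = I.atomVal ν A ∧ ¬ I.QFalse ν₂ C₁.body := by
    rintro W C₁ ⟨⟨π, rfl⟩, hfresh⟩
    classical
    -- Standardizing apart allows the two valuations to be glued: `ν₁`, renamed, on the clause
    -- variant, and `ν` everywhere else, in particular on `W` and on the current query.
    let ν₂ : ℕ → M := fun x => if VarInClause x (C.apply (permSubst π)) then ν₁ (π.symm x) else ν x
    have hν₂ : ∀ x, VarInClause x C → ν₂ (π x) = ν₁ x := by
      intro x hx
      have : VarInClause (π x) (C.apply (permSubst π)) := by
        rcases hx with ⟨i, hx⟩ | hx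
        · exact Or.inl ⟨i, (mem_varFinset_subst _ _).2 ⟨x, hx, mem_varFinset_var.2 rfl⟩⟩
        · exact Or.inr (varInQuery_applyQ.2 ⟨x, hx, mem_varFinset_var.2 rfl⟩)
      simp [ν₂, this]
    refine ⟨ν₂, fun x hx => ?_, ?_, ?_⟩
    · by_cases hxC : VarInClause x (C.apply (permSubst π))
      · exact (hx.elim (hfresh x hxC).1 (hfresh x hxC).2).elim
      · simp [ν₂, hxC]
    · rw [Clause.apply, atomVal_applyA, ← hhead]
      exact I.atomVal_congr fun x hx => hν₂ x (Or.inl hx)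
    · rw [Clause.apply, qFalse_applyQ]
      exact fun hf => hbody ((I.qFalse_congr fun x hx => hν₂ x (Or.inr hx)).1 hf)
  refine ⟨C, hC, ?_, fun W C₁ θ hfresh hθ => ?_⟩
  · exact hI.headUnifiable_of_atomVal_eq hhead.symm
  · obtain ⟨ν₂, hν₂, hhead₂, hbody₂⟩ := key W C₁ hfresh
    have hG := (I.qFalse_congr fun x hx => hν₂ x (Or.inr hx)).not.2 h
    have hA₂ : I.atomVal ν₂ A = I.atomVal ν₂ C₁.head := by
      rw [hhead₂]
      exact I.atomVal_congr fun x ⟨i, hx⟩ => hν₂ x (Or.inr ⟨.pos A, by simp, i, hx⟩)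
    obtain ⟨μ, hμ⟩ := hI.exists_valuation_of_isMGU hθ hA₂
    refine ⟨μ, fun x hx => (hμ x).trans (hν₂ x (Or.inl hx)), ?_⟩
    rw [qFalse_applyQ, funext hμ, qFalse_append, qFalse_append]
    rw [qFalse_mid, qFalse_append] at hG
    tauto

end Interp3.IsModelComp

-- Leaves and answers of finite trees

theorem Tree.Failed.not_flounders {T : Tree L} (h : T.Failed) : ¬ T.Flounders := by
  induction T with
  | empty => exact h.elim
  | pos l A r S input mgu child ih => exact fun ⟨C, hC⟩ => ih C (h C) hC
  | neg l A r child ih => exact ih h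
  | negFailed l A r => exact id
  | floundered l A r => exact h.elim

theorem Tree.Failed.answers_eq_empty {T : Tree L} (h : T.Failed) (W : Query L) :
    T.answers W = ∅ := by
  induction T generalizing W with
  | empty => exact h.elim
  | pos l A r S input mgu child ih =>
    ext X
    simp [Tree.answers, ih _ (h _)]
  | neg l A r child ih => exact ih h W
  | negFailed l A r => rfl
  | floundered l A r => rfl

theorem Tree.exists_answer {T : Tree L} (h : ¬ T.Failed) (hfl : ¬ T.Flounders) (W : Query L) :
    ∃ X, X ∈ T.answers W := by
  induction T generalizing W with
  | empty => exact ⟨W, rfl⟩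
  | pos l A r S input mgu child ih =>
    obtain ⟨C, hC⟩ := not_forall.1 h
    obtain ⟨X, hX⟩ := ih C hC (fun h' => hfl ⟨C, h'⟩) (applyQ (mgu C) W)
    exact ⟨X, C, hX⟩
  | neg l A r child ih => exact ih h hfl W
  | negFailed l A r => exact (h trivial).elim
  | floundered l A r => exact (hfl trivial).elim

/-- Needed so that, among infinitely many constants, infinitely many occur in no answer. -/
theorem Tree.finite_answers (T : Tree L) (W : Query L) : (T.answers W).Finite := by
  induction T generalizing W with
  | empty => exact Set.finite_singleton W
  | pos l A r S input mgu child ih =>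
    have : (Tree.pos l A r S input mgu child).answers W =
        ⋃ C, (child C).answers (applyQ (mgu C) W) := by
      ext X
      simp [Tree.answers]
    rw [this]
    exact Set.finite_iUnion fun C => ih C _
  | neg l A r child ih => exact ih W
  | negFailed l A r => exact Set.finite_empty
  | floundered l A r => exact Set.finite_empty

/-- `X` is an instance of `W`, by a substitution under which `G` is a consequence of the
completion of `P`. -/
def SoundAnswer (P : Program L) (W G X : Query L) : Prop :=
  ∃ δ : Subst L, X = applyQ δ W ∧ CompEntails P (applyQ δ G)

theorem SoundAnswer.empty (P : Program L) (W : Query L) : SoundAnswer P W [] W :=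
  ⟨Term.var, (applyQ_var W).symm, fun _ _ _ _ _ _ h => (List.not_mem_nil h).elim⟩

theorem SoundAnswer.pos {P : Program L} {W l r X : Query L} {A : Atom L} {C C₁ : Clause L}
    {θ : Subst L} (hC : C ∈ P) (hvar : IsVariantC C C₁) (hθ : IsMGU θ A C₁.head)
    (h : SoundAnswer P (applyQ θ W) (applyQ θ (l ++ C₁.body ++ r)) X) :
    SoundAnswer P W (l ++ .pos A :: r) X := by
  obtain ⟨δ, rfl, hδ⟩ := h
  refine ⟨_, applyQ_applyQ θ δ W, fun M _ I hI ν => ?_⟩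
  have h' := hδ M I hI ν
  rw [applyQ_applyQ, I.qTrue_applyQ] at h'
  refine (I.qTrue_applyQ _ _ _).2 (hI.qTrue_of_resolvent hC hvar ?_ h')
  simp only [I.val_subst, ← I.atomVal_applyA, hθ.1]

theorem SoundAnswer.neg {P : Program L} {W l r X : Query L} {A : Atom L}
    (hA : CompEntailsNot P [.pos A]) (h : SoundAnswer P W (l ++ r) X) :
    SoundAnswer P W (l ++ .neg A :: r) X := by
  obtain ⟨δ, rfl, hδ⟩ := h
  refine ⟨δ, rfl, fun M _ I hI ν => ?_⟩
  have h' := hδ M I hI ν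
  rw [I.qTrue_applyQ] at h' ⊢
  obtain ⟨k, hk, hkA⟩ := hA M I hI fun x => I.val ν (δ x)
  obtain rfl := List.mem_singleton.1 hk
  exact (I.qTrue_mid _ _ _ _).2 ⟨hkA, h'⟩

/-- In each model of the completion of `P`, each valuation under which `G` is not false is covered
by an answer of `T`, unless `T` flounders. -/
def CoveredByAnswers (P : Program L) (W G : Query L) (T : Tree L) : Prop :=
  ∀ (M : Type (max u v)) [Nonempty M] (I : Interp3 L M), I.IsModelComp P → ∀ ν : ℕ → M,
    ¬ I.QFalse ν G → T.Flounders ∨ ∃ η : Subst L, applyQ η W ∈ T.answers W ∧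
      ∃ μ : ℕ → M, ∀ x, VarInQuery x W → I.val μ (η x) = ν x

theorem CoveredByAnswers.pos {P : Program L} {W l r : Query L} {A : Atom L} {S : Finset (Clause L)}
    {input : {C // C ∈ S} → Clause L} {mgu : {C // C ∈ S} → Subst L}
    {child : {C // C ∈ S} → Tree L}
    (hS : ∀ C, C ∈ S ↔ C ∈ P ∧ HeadUnifiable A C)
    (hinput : ∀ C, FreshVariant W (l ++ .pos A :: r) C.1 (input C))
    (hmgu : ∀ C, IsMGU (mgu C) A (input C).head)
    (h : ∀ C, CoveredByAnswers P (applyQ (mgu C) W)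
      (applyQ (mgu C) (l ++ (input C).body ++ r)) (child C)) :
    CoveredByAnswers P W (l ++ .pos A :: r) (.pos l A r S input mgu child) := by
  intro M _ I hI ν hν
  obtain ⟨C, hC, hunif, hres⟩ := hI.exists_resolvent_not_qFalse hν
  let c : {C // C ∈ S} := ⟨C, (hS C).2 ⟨hC, hunif⟩⟩
  obtain ⟨μ, hμ, hG⟩ := hres W (input c) (mgu c) (hinput c) (hmgu c)
  rcases h c M I hI μ hG with hfl | ⟨η, hη, ρ, hρ⟩
  · exact Or.inl ⟨c, hfl⟩
  · refine Or.inr ⟨fun x => (mgu c x).subst η, ⟨c, ?_⟩, ρ, fun x hx => ?_⟩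
    · rwa [← applyQ_applyQ]
    -- The child covers `μ` only on the variables of `W` instantiated by the mgu, which are all that
    -- occur in `mgu c x`.
    · rw [I.val_subst, ← hμ x hx]
      exact I.val_congr _ fun y hy => hρ y (varInQuery_applyQ.2 ⟨x, hx, hy⟩)

/-- Dropping a conjunct cannot make a query false, so nothing about `A` is needed here; its finite
failure matters only for the soundness of answers. -/
theorem CoveredByAnswers.neg {P : Program L} {W l r : Query L} {A : Atom L} {T : Tree L}
    (h : CoveredByAnswers P W (l ++ r) T) :
    CoveredByAnswers P W (l ++ .neg A :: r) (.neg l A r T) :=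
  fun M _ I hI ν hν => h M I hI ν fun hf => hν ((I.qFalse_mid _ _ _ _).2 (Or.inr hf))

/-- Coverage is vacuous: `A` is true in every model under all valuations, so a query containing `¬A`
is false. -/
theorem CoveredByAnswers.negFailed {P : Program L} (W l r X : Query L) {A : Atom L}
    (hX : IsVariantQ [.pos A] X) (h : CompEntails P X) :
    CoveredByAnswers P W (l ++ .neg A :: r) (.negFailed l A r) := by
  intro M _ I hI ν hν
  obtain ⟨π, rfl⟩ := hX
  have h' := h M I hI fun x => ν (π.symm x)
  rw [I.qTrue_applyQ] at h'
  refine (hν ((I.qFalse_mid _ _ _ _).2 (Or.inl ?_))).elim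
  have hA := h' _ (List.mem_singleton.2 rfl)
  simp only [permSubst, Interp3.val, Equiv.symm_apply_apply] at hA
  exact hA

/-- Simultaneous induction over trees, finite failure and successful derivations. Coverage for a
failed tree, which has neither answers nor floundered leaves, shows that its root is false in every
model; this is what selected negative literals require in the soundness of answers. -/
theorem MainSubtree.sound {P : Program L} {D : Atom L → Prop} {W G : Query L} {T : Tree L}
    (h : MainSubtree P D W G T) :
    (∀ X ∈ T.answers W, SoundAnswer P W G X) ∧ CoveredByAnswers P W G T := by
  refine MainSubtree.rec
    (motive_1 := fun W G T _ => (∀ X ∈ T.answers W, SoundAnswer P W G X) ∧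
      CoveredByAnswers P W G T)
    (motive_2 := fun Q _ => CompEntailsNot P Q)
    (motive_3 := fun W G X _ => SoundAnswer P W G X) ?_ ?_ ?_ ?_ ?_ ?_ ?_ ?_ ?_ h
  · refine fun W => ⟨fun X hX => ?_,
      fun M _ I hI ν _ => Or.inr ⟨Term.var, applyQ_var W, ν, fun _ _ => rfl⟩⟩
    obtain rfl : X = W := hX
    exact SoundAnswer.empty P X
  · intro W l A r S input mgu child hS hinput hmgu _ ih
    exact ⟨fun X ⟨C, hC⟩ => SoundAnswer.pos ((hS _).1 C.2).1 (hinput C).1 (hmgu C) ((ih C).1 X hC),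
      CoveredByAnswers.pos hS hinput hmgu fun C => (ih C).2⟩
  · intro W l A r child _ _ _ ihfail ih
    exact ⟨fun X hX => (ih.1 X hX).neg ihfail, ih.2.neg⟩
  · intro W l A r _ X hX _ ih
    refine ⟨fun X hX => hX.elim, CoveredByAnswers.negFailed W l r X hX ?_⟩
    obtain ⟨δ, rfl, h⟩ := ih
    exact h
  · exact fun W l A r _ => ⟨fun X hX => hX.elim, fun M _ I hI ν _ => Or.inl trivial⟩
  · intro Q T _ hfailed ih M _ I hI ν
    by_contra hν
    rcases ih.2 M I hI ν hν with hfl | ⟨η, hη, _⟩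
    · exact hfailed.not_flounders hfl
    · rw [hfailed.answers_eq_empty] at hη
      exact hη
  · exact SoundAnswer.empty P
  · exact fun W l A r C C₁ θ X hC hinput hmgu _ ih => ih.pos hC hinput.1 hmgu
  · exact fun W l A r X _ _ _ ihfail ih => ih.neg ihfail

/-! ### Specifications and ground instances of answers -/

theorem holdsLit_map_applyA {R : ℕ → Type v} (I : Herbrand L R) (ν : ℕ → L.Term Empty)
    (σ : Subst L) (l : Literal (AtomOver L R)) :
    HoldsLit I ν (l.map (applyA σ)) ↔ HoldsLit I (fun x => (σ x).subst ν) l := by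
  cases l <;> simp only [HoldsLit, Literal.map, applyA, RAtom.map_map, subst_subst]

theorem sat_applyQ {R : ℕ → Type v} {I : Herbrand L R} {Q : QueryOver L R} (h : Sat I Q)
    (σ : Subst L) : Sat I (applyQ σ Q) := by
  intro ν l hl
  obtain ⟨k, hk, rfl⟩ := List.mem_map.1 hl
  exact (holdsLit_map_applyA _ _ _ _).2 (h _ k hk)

theorem satNot_applyQ {R : ℕ → Type v} {I : Herbrand L R} {Q : QueryOver L R} (h : SatNot I Q)
    (σ : Subst L) : SatNot I (applyQ σ Q) :=
  fun _ hν => h _ fun _ hk => (holdsLit_map_applyA _ _ _ _).1 (hν _ (List.mem_map_of_mem hk))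

/-- A constant supplies a ground valuation; if there were none, both conditions would hold
vacuously. -/
theorem Sat.not_satNot (hconst : Nonempty (L.Functions 0)) {R : ℕ → Type v} {I : Herbrand L R}
    {Q : QueryOver L R} (h : Sat I Q) : ¬ SatNot I Q :=
  fun hn => hn (fun _ => .func hconst.some Fin.elim0) (h _)

theorem primePos_applyQ (σ : Subst L) (Q : Query L) :
    primePos (applyQ σ Q) = applyQ σ (primePos Q) := by
  simp only [primePos, applyQ, List.map_map]
  refine List.map_congr_left fun l _ => ?_
  cases l <;> rfl

theorem primeNeg_applyQ (σ : Subst L) (Q : Query L) :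
    primeNeg (applyQ σ Q) = applyQ σ (primeNeg Q) := by
  simp only [primeNeg, applyQ, List.map_map]
  refine List.map_congr_left fun l _ => ?_
  cases l <;> rfl

namespace Interp3.IsModelComp

variable {M : Type*} {I : Interp3 L M} {P : Program L}

/-- With no variables, the minimality condition of `eq_of_val_eq` is empty. -/
theorem eq_of_val_eq_of_ground (hI : I.IsModelComp P) {μ ν : ℕ → M} {s t : L.Term ℕ}
    (hs : ∀ x, x ∉ s.varFinset) (ht : ∀ x, x ∉ t.varFinset) (h : I.val μ s = I.val ν t) :
    s = t :=
  hI.eq_of_val_eq (V := ∅) (μ := ν) (fun x _ hx => (Finset.notMem_empty x hx).elim) s t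
    (fun x hx => (hs x hx).elim) (fun x hx => (ht x hx).elim)
    ((I.val_congr s fun x hx => (hs x hx).elim).trans h)

/-- A term with the same value as a ground term is more general than it, by a substitution that
depends only on the valuation of the variables of the term. -/
theorem exists_matching (hI : I.IsModelComp P) (μ : ℕ → M) :
    ∃ δ : Subst L, ∀ (s t : L.Term ℕ) (ν : ℕ → M), (∀ x, x ∉ t.varFinset) →
      I.val μ s = I.val ν t → s.subst δ = t := by
  classical
  -- A variable is sent to a ground term denoting its value, if there is one. Such a term is unique,
  -- and its value is the same under all valuations.
  let p : ℕ → L.Term ℕ → Prop := fun x g =>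
    (∀ y, y ∉ g.varFinset) ∧ ∃ ν : ℕ → M, μ x = I.val ν g
  refine ⟨fun x => if h : ∃ g, p x g then h.choose else .var x, fun s => ?_⟩
  induction s with
  | var x =>
    intro t ν ht h
    have hx : ∃ g, p x g := ⟨t, ht, ν, h⟩
    obtain ⟨hg, ν', hν'⟩ := hx.choose_spec
    simp only [Term.subst, dif_pos hx]
    exact hI.eq_of_val_eq_of_ground hg ht (hν'.symm.trans h)
  | func f ss ih =>
    intro t ν ht h
    cases t with
    | var y => exact (ht y (mem_varFinset_var.2 rfl)).elim
    | func g ts =>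
      have hfg := hI.func_eq h
      cases hfg
      simp only [Term.subst]
      congr 1
      funext i
      exact ih i (ts i) ν (fun x hx => ht x ((mem_varFinset_func _ _).2 ⟨i, hx⟩))
        (congrFun (hI.inj f _ _ h) i)

end Interp3.IsModelComp

-- Semi-completeness for ground instances; transfer to Kunen semantics

section Specification

variable {P : Program L} {D : Atom L → Prop} {S : Spec L} {Q : Query L} {T : Tree L}

/-- Each ground instance of the query that is true in the specification is an instance of an
answer. -/
theorem exists_answer_of_ground (hconst : Nonempty (L.Functions 0)) (hcorrect : CorrectKS P S)
    (hT : NonDivergingTree P D Q T) {θ : Subst L}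
    (hθ : ∀ x, VarInQuery x Q → ∀ y, y ∉ (θ x).varFinset)
    (hsat : Sat S.interp (applyQ θ (primePos Q))) :
    ∃ η δ : Subst L, applyQ η Q ∈ T.answers Q ∧ ∀ x, VarInQuery x Q → (η x).subst δ = θ x := by
  by_contra hno
  rw [← primePos_applyQ] at hsat
  -- Correctness reduces the contradiction to falsity of `Qθ` in all models; where `Qθ` is not
  -- false, coverage and matching produce the answer that `hno` excludes.
  refine hsat.not_satNot hconst ((hcorrect _).2 fun M _ I hI ν => ?_)
  rw [I.qFalse_applyQ]
  by_contra hν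
  obtain hfl | ⟨η, hη, μ, hμ⟩ := (MainSubtree.sound hT.1).2 M I hI _ hν
  · exact hT.2 hfl
  · obtain ⟨δ, hδ⟩ := hI.exists_matching μ
    exact hno ⟨η, δ, hη, fun x hx => hδ _ _ ν (hθ x hx) (hμ x hx)⟩

/-- A tree neither failed nor floundered has an answer, and by soundness and correctness the
specification satisfies the primed form of that instance of the query. -/
theorem failed_of_satNot (hcorrect : CorrectKS P S) (hconst : Nonempty (L.Functions 0))
    (hT : NonDivergingTree P D Q T) (h : SatNot S.interp (primeNeg Q)) : T.Failed := by
  by_contra hno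
  obtain ⟨X, hX⟩ := T.exists_answer hno hT.2 Q
  obtain ⟨δ, rfl, hδ⟩ := (MainSubtree.sound hT.1).1 X hX
  have hsat := (hcorrect _).1 hδ
  rw [primeNeg_applyQ] at hsat
  exact hsat.not_satNot hconst (satNot_applyQ h δ)

theorem groundSLDNFSemiCompleteFor (hconst : Nonempty (L.Functions 0))
    (hcorrect : CorrectKS P S) (Q : Query L) : GroundSLDNFSemiCompleteFor P D S Q := by
  refine fun T hT => ⟨fun θ hθ hsat => ?_, failed_of_satNot hcorrect hconst hT⟩
  obtain ⟨η, δ, hη, h⟩ := exists_answer_of_ground hconst hcorrect hT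
    (fun x hx y hy => hθ y (varInQuery_applyQ.2 ⟨x, hx, hy⟩)) hsat
  refine ⟨_, hη, δ, ?_⟩
  rw [applyQ_applyQ]
  exact applyQ_congr fun x hx => (h x hx).symm

/-- For truth, the identity substitution gives an answer more general than `Q`, and answers are
consequences of the completion. For falsity, a failed tree has no answers, so coverage leaves no
valuation under which `Q` is not false. -/
theorem semiCompleteKSFor (h : SLDNFSemiCompleteFor P D S Q) : SemiCompleteKSFor P D S Q := by
  rintro ⟨T, hT⟩
  refine ⟨fun hsat => ?_, fun hsat => ?_⟩
  · obtain ⟨X, hX, ρ, hρ⟩ := (h T hT).1 Term.var (sat_applyQ hsat _)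
    obtain ⟨δ, rfl, hδ⟩ := (MainSubtree.sound hT.1).1 X hX
    intro M _ I hI ν
    rw [applyQ_var] at hρ
    rw [hρ, I.qTrue_applyQ]
    exact hδ M I hI _
  · intro M _ I hI ν
    by_contra hν
    have hfailed := (h T hT).2 hsat
    obtain hfl | ⟨η, hη, _⟩ := (MainSubtree.sound hT.1).2 M I hI ν hν
    · exact hT.2 hfl
    · rw [hfailed.answers_eq_empty] at hη
      exact hη

end Specification

/-! ### Occurrences of function symbols -/

section Occurrences

variable {n : ℕ} {f : L.Functions n}

theorem funInTerm_subst {t : L.Term ℕ} {σ : Subst L} :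
    FunInTerm f (t.subst σ) ↔ FunInTerm f t ∨ ∃ x ∈ t.varFinset, FunInTerm f (σ x) := by
  induction t with
  | var x => simp [Term.subst, FunInTerm, Term.varFinset]
  | func g ts ih =>
    simp only [Term.subst, FunInTerm, ih, mem_varFinset_func, exists_or, or_assoc]
    refine or_congr_right (or_congr_right ?_)
    exact ⟨fun ⟨i, x, hx, h⟩ => ⟨x, ⟨i, hx⟩, h⟩, fun ⟨x, ⟨i, hx⟩, h⟩ => ⟨i, x, hx, h⟩⟩

theorem funInQuery_applyQ {Q : Query L} {σ : Subst L} :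
    FunInQuery f (applyQ σ Q) ↔ FunInQuery f Q ∨ ∃ x, VarInQuery x Q ∧ FunInTerm f (σ x) := by
  have key : FunInQuery f (applyQ σ Q) ↔ ∃ l ∈ Q, ∃ i, FunInTerm f ((l.atom.args i).subst σ) := by
    simp only [FunInQuery, applyQ, List.mem_map, exists_exists_and_eq_and]
    refine exists_congr fun l => and_congr_right fun _ => ?_
    cases l <;> rfl
  rw [key]
  simp only [funInTerm_subst]
  constructor
  · rintro ⟨l, hl, i, h | ⟨x, hx, h⟩⟩
    · exact Or.inl ⟨l, hl, i, h⟩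
    · exact Or.inr ⟨x, ⟨l, hl, i, hx⟩, h⟩
  · rintro (⟨l, hl, i, h⟩ | ⟨x, ⟨l, hl, i, hx⟩, h⟩)
    · exact ⟨l, hl, i, Or.inl h⟩
    · exact ⟨l, hl, i, Or.inr ⟨x, hx, h⟩⟩

theorem funInQuery_append {Q₁ Q₂ : Query L} :
    FunInQuery f (Q₁ ++ Q₂) ↔ FunInQuery f Q₁ ∨ FunInQuery f Q₂ := by
  simp only [FunInQuery, List.mem_append, or_and_right, exists_or]

theorem funInQuery_mid {l r : Query L} {k : Literal (Atom L)} :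
    FunInQuery f (l ++ k :: r) ↔ FunInAtom f k.atom ∨ FunInQuery f (l ++ r) := by
  simp only [FunInQuery, List.mem_append, List.mem_cons, or_and_right, exists_or, exists_eq_left]
  exact or_left_comm

theorem finite_setOf_varInQuery (Q : Query L) : {x | VarInQuery x Q}.Finite := by
  have : {x | VarInQuery x Q} =
      ⋃ l ∈ {l | l ∈ Q}, ⋃ i, (((l : Literal (Atom L)).atom.args i).varFinset : Set ℕ) := by
    ext x
    simp [VarInQuery, VarInAtom]
  rw [this]
  exact (List.finite_toSet Q).biUnion fun l _ => Set.finite_iUnion fun i => Finset.finite_toSet _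

theorem finite_setOf_constInTerm (t : L.Term ℕ) : {c : L.Functions 0 | FunInTerm c t}.Finite := by
  induction t with
  | var x => exact Set.finite_empty
  | @func m g ts ih =>
    have : {c : L.Functions 0 | FunInTerm c (.func g ts)} =
        {c | (⟨0, c⟩ : Σ k, L.Functions k) = ⟨m, g⟩} ∪ ⋃ i, {c | FunInTerm c (ts i)} := by
      ext c
      simp [FunInTerm]
    rw [this]
    refine Set.Finite.union (Set.Subsingleton.finite fun c hc d hd => ?_) (Set.finite_iUnion ih)
    simpa using hc.trans hd.symm

theorem finite_setOf_constInQuery (Q : Query L) :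
    {c : L.Functions 0 | FunInQuery c Q}.Finite := by
  have : {c : L.Functions 0 | FunInQuery c Q} =
      ⋃ l ∈ {l | l ∈ Q}, ⋃ i, {c | FunInTerm c ((l : Literal (Atom L)).atom.args i)} := by
    ext c
    simp [FunInQuery, FunInAtom]
  rw [this]
  exact (List.finite_toSet Q).biUnion fun l _ =>
    Set.finite_iUnion fun i => finite_setOf_constInTerm _

end Occurrences

/-! ### Replacing subterms by variables -/

/-- All subterms that are not variables have the property `p`. -/
def AllSubterms (p : L.Term ℕ → Prop) : L.Term ℕ → Prop
  | .var _ => True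
  | .func f ts => p (.func f ts) ∧ ∀ i, AllSubterms p (ts i)

theorem AllSubterms.mono {p q : L.Term ℕ → Prop} (hpq : ∀ t, p t → q t) {t : L.Term ℕ}
    (h : AllSubterms p t) : AllSubterms q t := by
  induction t with
  | var x => trivial
  | func f ts ih => exact ⟨hpq _ h.1, fun i => ih i (h.2 i)⟩

/-- No instance of a subterm starts with a function symbol that does not occur in the term. -/
theorem allSubterms_of_not_funInTerm {ι : Type*} {n : ℕ} {f : ι → L.Functions n} {t : L.Term ℕ}
    (h : ∀ y, ¬ FunInTerm (f y) t) :
    AllSubterms (fun s => ∀ (δ : Subst L) (y : ι) (us : Fin n → L.Term ℕ),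
      s.subst δ ≠ .func (f y) us) t := by
  induction t with
  | var x => trivial
  | func g ts ih =>
    refine ⟨fun δ y us heq => h y (Or.inl ?_), fun i => ih i fun y hy => h y (Or.inr ⟨i, hy⟩)⟩
    simp only [Term.subst] at heq
    cases heq
    rfl

/-- Replace the maximal non-variable subterms for which `c` provides a variable. -/
def replaceSubterms (c : L.Term ℕ → Option ℕ) : L.Term ℕ → L.Term ℕ
  | .var x => .var x
  | .func f ts => (c (.func f ts)).elim (.func f fun i => replaceSubterms c (ts i)) .var

/-- No non-variable subterm of `t` becomes replaceable under `θ`, so replacement passes through the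
skeleton of `t` and acts only inside the values of `θ`. -/
theorem replaceSubterms_subst {c : L.Term ℕ → Option ℕ} {θ : Subst L} {t : L.Term ℕ}
    (h : AllSubterms (fun s => c (s.subst θ) = none) t) :
    replaceSubterms c (t.subst θ) = t.subst fun x => replaceSubterms c (θ x) := by
  induction t with
  | var x => rfl
  | func f ts ih =>
    have h₁ := h.1
    simp only [Term.subst] at h₁ ⊢
    simp only [replaceSubterms, h₁, Option.elim_none]
    congr 1
    funext i
    exact ih i (h.2 i)

open Classical in
/-- If `σ` maps the variables to different terms that are not instances of non-variable subterms of
`s` by `σ` or of `t` by `δ`, then they can be replaced by variables in `t.subst δ = s.subst σ`. -/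
theorem exists_generalization {σ : Subst L} (hσ : Function.Injective σ)
    (hvar : ∀ x y, σ x ≠ .var y) (δ : Subst L) :
    ∃ δ' : Subst L, ∀ s t : L.Term ℕ,
      AllSubterms (fun u => ∀ y, u.subst σ ≠ σ y) s → AllSubterms (fun u => ∀ y, u.subst δ ≠ σ y) t →
      t.subst δ = s.subst σ → t.subst δ' = s := by
  -- A partial inverse of `σ`; replacement along it is applied below to both sides of `t.subst δ =
  -- s.subst σ`.
  let c : L.Term ℕ → Option ℕ := fun u => if h : ∃ x, σ x = u then some h.choose else none
  have hnone : ∀ u, (∀ y, u ≠ σ y) → c u = none := fun u hu =>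
    dif_neg fun ⟨y, hy⟩ => hu y hy.symm
  have hsome : ∀ x, c (σ x) = some x := by
    intro x
    have hx : ∃ y, σ y = σ x := ⟨x, rfl⟩
    simp only [c, dif_pos hx, hσ hx.choose_spec]
  have hrep : ∀ x, replaceSubterms c (σ x) = .var x := by
    intro x
    have hx := hsome x
    cases h : σ x with
    | var y => exact (hvar x y h).elim
    | func f ts =>
      rw [h] at hx
      simp [replaceSubterms, hx]
  refine ⟨fun x => replaceSubterms c (δ x), fun s t hs ht h => ?_⟩
  rw [← replaceSubterms_subst (ht.mono fun u hu => hnone _ hu), h,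
    replaceSubterms_subst (hs.mono fun u hu => hnone _ hu), funext hrep, subst_var]

/-! ### A function symbol that does not occur in the program and the query -/

section NotOccurring

variable {n : ℕ} {f : L.Functions n}

open Classical in
/-- A most general unifier introduces no function symbols. -/
theorem IsMGU.not_funInTerm {θ : Subst L} {A B : Atom L} (hθ : IsMGU θ A B)
    (hA : ¬ FunInAtom f A) (hB : ¬ FunInAtom f B) (x : ℕ) : ¬ FunInTerm f (θ x) := by
  -- Every term headed by `f` is replaced by the variable 0; the choice of the variable is
  -- immaterial.
  let c : L.Term ℕ → Option ℕ := fun u => if ∃ us, u = .func f us then some 0 else none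
  have hfree : ∀ t, ¬ FunInTerm f (replaceSubterms c t) := by
    intro t
    induction t with
    | var x => exact id
    | func g ts ih =>
      by_cases hg : ∃ us, Term.func g ts = .func f us
      · simp only [replaceSubterms, c, if_pos hg, Option.elim_some]
        exact id
      · simp only [replaceSubterms, c, if_neg hg, Option.elim_none, FunInTerm, not_or, not_exists]
        refine ⟨fun h => hg ?_, ih⟩
        cases h
        exact ⟨ts, rfl⟩
  have hrep : ∀ t, ¬ FunInTerm f t →
      t.subst (fun x => replaceSubterms c (θ x)) = replaceSubterms c (t.subst θ) := fun t ht =>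
    (replaceSubterms_subst ((allSubterms_of_not_funInTerm (f := fun _ : Unit => f)
      fun _ => ht).mono fun u hu => if_neg fun ⟨us, h⟩ => hu θ () us h)).symm
  -- Since `A` and `B` do not contain `f`, the mgu with its `f`-terms replaced is still a unifier,
  -- hence an instance of `θ`. An `f` in `θ x` would survive in that instance, which is free of `f`.
  obtain ⟨δ, hδ⟩ := hθ.2 (fun x => replaceSubterms c (θ x)) <|
    RAtom.map_eq_map_of (fun i j h => by
      rw [hrep _ fun h' => hA ⟨i, h'⟩, hrep _ fun h' => hB ⟨j, h'⟩, h]) hθ.1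
  intro hx
  refine hfree (θ x) ?_
  rw [congrFun hδ x]
  exact funInTerm_subst.2 (Or.inl hx)

theorem not_funInAtom_applyA {σ : Subst L} {A : Atom L} (hσ : ∀ x, ¬ FunInTerm f (σ x))
    (hA : ¬ FunInAtom f A) : ¬ FunInAtom f (applyA σ A) := by
  rintro ⟨i, hi⟩
  obtain h | ⟨x, _, h⟩ := funInTerm_subst.1 hi
  · exact hA ⟨i, h⟩
  · exact hσ x h

theorem not_funInQuery_applyQ {σ : Subst L} {Q : Query L} (hσ : ∀ x, ¬ FunInTerm f (σ x))
    (hQ : ¬ FunInQuery f Q) : ¬ FunInQuery f (applyQ σ Q) := fun h =>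
  (funInQuery_applyQ.1 h).elim hQ fun ⟨x, _, hx⟩ => hσ x hx

/-- Neither clause variants nor mgus bring in `f`, and negative literals contribute no substitution.
-/
theorem MainSubtree.not_funInQuery_answer {P : Program L} {D : Atom L → Prop} {W G : Query L}
    {T : Tree L} (h : MainSubtree P D W G T) (hP : ¬ FunInProgram f P) (hW : ¬ FunInQuery f W)
    (hG : ¬ FunInQuery f G) : ∀ X ∈ T.answers W, ¬ FunInQuery f X := by
  induction T generalizing W G with
  | empty =>
    intro X hX
    obtain rfl : X = W := hX
    exact hW
  | pos l A r S input mgu child ih =>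
    cases h with
    | pos _ _ _ _ _ _ _ _ hS hinput hmgu hchild =>
    rintro X ⟨C, hX⟩
    rw [funInQuery_mid, funInQuery_append, not_or, not_or] at hG
    have hC : ¬ FunInAtom f (input C).head ∧ ¬ FunInQuery f (input C).body := by
      obtain ⟨π, hπ⟩ := (hinput C).1
      have hC' := not_or.1 fun h => hP ⟨C.1, ((hS _).1 C.2).1, h⟩
      rw [hπ]
      exact ⟨not_funInAtom_applyA (fun _ => id) hC'.1, not_funInQuery_applyQ (fun _ => id) hC'.2⟩
    have hθ := (hmgu C).not_funInTerm hG.1 hC.1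
    refine ih C (hchild C) (not_funInQuery_applyQ hθ hW) (not_funInQuery_applyQ hθ ?_) X hX
    rw [funInQuery_append, funInQuery_append]
    tauto
  | neg l A r child ih =>
    cases h with
    | neg _ _ _ _ _ _ _ hchild =>
    exact ih hchild hW fun h => hG (funInQuery_mid.2 (Or.inr h))
  | negFailed l A r => exact fun X hX => hX.elim
  | floundered l A r => exact fun X hX => hX.elim

end NotOccurring

/-! ### Extended languages -/

/-- The nesting depth of function symbols. -/
def depth : L.Term ℕ → ℕ
  | .var _ => 0
  | .func _ ts => (Finset.univ.sup fun i => depth (ts i)) + 1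

theorem depth_lt_depth_func {n : ℕ} (f : L.Functions n) (ts : Fin n → L.Term ℕ) (i : Fin n) :
    depth (ts i) < depth (.func f ts) :=
  Nat.lt_succ_of_le (Finset.le_sup (f := fun i => depth (ts i)) (Finset.mem_univ i))

/-- The complete ground term of depth `m + 1` built from `f`, with the constant `c` as leaves. -/
def tower {n : ℕ} (f : L.Functions n) (c : L.Functions 0) : ℕ → L.Term ℕ
  | 0 => .func c Fin.elim0
  | m + 1 => .func f fun _ => tower f c m

section Tower

variable {n : ℕ} {f : L.Functions n} {c : L.Functions 0}

theorem tower_ground (m x : ℕ) : x ∉ (tower f c m).varFinset := by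
  induction m with
  | zero => exact fun h => ((mem_varFinset_func _ _).1 h).elim fun i => i.elim0
  | succ m ih => exact fun h => ((mem_varFinset_func _ _).1 h).elim fun _ => ih

/-- Positive arity keeps `f` apart from the constant `c` and gives an argument along which to
descend. -/
theorem tower_injective (hn : 0 < n) : Function.Injective (tower f c) := by
  intro k
  induction k with
  | zero =>
    intro m h
    cases m with
    | zero => rfl
    | succ m =>
      simp only [tower, Term.func.injEq] at h
      exact (hn.ne h.1).elim
  | succ k ih =>
    intro m h
    cases m with
    | zero =>
      simp only [tower, Term.func.injEq] at h
      exact (hn.ne' h.1).elim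
    | succ m =>
      simp only [tower, Term.func.injEq, heq_eq_eq, true_and] at h
      rw [ih (congrFun h ⟨0, hn⟩)]

/-- An instance of a term by towers is itself a tower only if it is low, or if the term is built
with `f` on top of a variable. -/
theorem eq_add_of_subst_eq_tower (hn : 0 < n) {g : ℕ → ℕ} {t : L.Term ℕ} {m : ℕ}
    (h : t.subst (fun x => tower f c (g x)) = tower f c m) :
    m < depth t ∨ ∃ z k, k ≤ depth t ∧ m = g z + k ∧ (k = 0 → ∃ y, t = .var y) := by
  induction t generalizing m with
  | var x => exact Or.inr ⟨x, 0, le_rfl, (tower_injective hn h).symm, fun _ => ⟨x, rfl⟩⟩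
  | func f' ts ih =>
    cases m with
    | zero => exact Or.inl (Nat.succ_pos _)
    | succ m =>
      simp only [Term.subst, tower] at h
      obtain ⟨rfl, hf, hts⟩ := Term.func.inj h
      -- Only the path of first arguments is followed; `k` counts the steps on it down to a
      -- variable.
      have hd := depth_lt_depth_func f' ts ⟨0, hn⟩
      obtain hlt | ⟨z, k, hk, hm, _⟩ := ih _ (congrFun (eq_of_heq hts) ⟨0, hn⟩)
      · exact Or.inl (by omega)
      · exact Or.inr ⟨z, k + 1, by omega, by omega, fun h => (Nat.succ_ne_zero k h).elim⟩

/-- Tower indices are spaced by `N`, beyond the depth of `t`. A non-variable subterm adds some `k`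
with `0 < k < N` to an index and so misses all multiples of `N`; the shift `x + 1` makes every index
at least `N`, which excludes the low case. -/
theorem allSubterms_subst_ne_tower (hn : 0 < n) {N : ℕ} {t : L.Term ℕ} (ht : depth t < N) :
    AllSubterms (fun u => ∀ y, u.subst (fun x => tower f c (N * (x + 1))) ≠
      tower f c (N * (y + 1))) t := by
  induction t with
  | var x => trivial
  | func g ts ih =>
    refine ⟨fun y h => ?_, fun i => ih i ((depth_lt_depth_func g ts i).trans ht)⟩
    obtain hlt | ⟨z, k, hk, hm, hk₀⟩ := eq_add_of_subst_eq_tower hn (g := fun x => N * (x + 1)) h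
    · have : N * 1 ≤ N * (y + 1) := Nat.mul_le_mul_left N (by omega)
      omega
    · have hdvd : N ∣ k := (Nat.dvd_add_right (Dvd.intro _ rfl)).1 (hm ▸ Dvd.intro _ rfl)
      obtain ⟨x, hx⟩ := hk₀ (Nat.eq_zero_of_dvd_of_lt hdvd (by omega))
      cases hx

end Tower

/-- In an extended language there is a grounding substitution whose values can be generalized to
variables again, in instances of the answers and in the given terms. -/
theorem exists_grounding (hconst : Nonempty (L.Functions 0)) {P : Program L} {D : Atom L → Prop}
    {Q : Query L} {T : Tree L} (hext : Extended P Q) (hT : IsMainTree P D Q T) (θ : Subst L) :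
    ∃ σ : Subst L, Function.Injective σ ∧ (∀ x y, y ∉ (σ x).varFinset) ∧
      (∀ x, VarInQuery x Q → AllSubterms (fun u => ∀ y, u.subst σ ≠ σ y) (θ x)) ∧
      ∀ η : Subst L, applyQ η Q ∈ T.answers Q → ∀ x, VarInQuery x Q → ∀ δ : Subst L,
        AllSubterms (fun u => ∀ y, u.subst δ ≠ σ y) (η x) := by
  obtain hinf | ⟨n, f, hn, hfP, hfQ⟩ := hext
  -- Distinct constants are used that occur neither in the answers of `T` nor in the values of `θ`
  -- on the variables of `Q`.
  · have hfin : ((⋃ X ∈ T.answers Q, {c : L.Functions 0 | FunInQuery c X}) ∪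
        ⋃ x ∈ {x | VarInQuery x Q}, {c | FunInTerm c (θ x)}).Finite :=
      ((T.finite_answers Q).biUnion fun X _ => finite_setOf_constInQuery X).union
        ((finite_setOf_varInQuery Q).biUnion fun x _ => finite_setOf_constInTerm _)
    let e := hfin.infinite_compl.natEmbedding
    have he := fun y => (e y).2
    simp only [Set.mem_compl_iff, Set.mem_union, Set.mem_iUnion, Set.mem_ofPred_eq, not_or,
      not_exists] at he
    refine ⟨fun x => .func (e x).1 Fin.elim0, fun x y h => ?_, fun x y h => ?_, fun x hx => ?_,
      fun η hη x hx δ => ?_⟩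
    · simp only [Term.func.injEq, heq_eq_eq, true_and, and_true] at h
      exact e.injective (Subtype.ext h)
    · exact ((mem_varFinset_func _ _).1 h).elim fun i => i.elim0
    · exact (allSubterms_of_not_funInTerm (f := fun y => (e y).1) fun y => (he y).2 x hx).mono
        fun u hu y => hu _ y _
    · exact (allSubterms_of_not_funInTerm (f := fun y => (e y).1) fun y h =>
        (he y).1 _ hη (funInQuery_applyQ.2 (Or.inr ⟨x, hx, h⟩))).mono fun u hu y => hu _ y _
  -- The symbol `f` may occur in `θ`, so towers must be spaced wider than the depth of its values;
  -- the answers do not contain `f` at all.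
  · obtain ⟨N, hN⟩ := ((finite_setOf_varInQuery Q).image fun x => depth (θ x)).bddAbove
    have hN' : ∀ x, VarInQuery x Q → depth (θ x) < N + 1 := fun x hx =>
      Nat.lt_succ_of_le (hN ⟨x, hx, rfl⟩)
    refine ⟨fun x => tower f hconst.some ((N + 1) * (x + 1)), fun x y h => ?_,
      fun x y => tower_ground _ _, fun x hx => allSubterms_subst_ne_tower hn (hN' x hx),
      fun η hη x hx δ => ?_⟩
    · exact Nat.succ_injective (Nat.eq_of_mul_eq_mul_left (Nat.succ_pos N) (tower_injective hn h))
    · have hηx : ¬ FunInTerm f (η x) := fun h =>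
        MainSubtree.not_funInQuery_answer hT hfP hfQ hfQ _ hη
          (funInQuery_applyQ.2 (Or.inr ⟨x, hx, h⟩))
      refine (allSubterms_of_not_funInTerm (f := fun _ : Unit => f) fun _ => hηx).mono
        fun u hu y h => ?_
      -- The index is positive, so the tower starts with `f` and not with the constant, which may
      -- occur in answers.
      obtain ⟨m, hm⟩ : ∃ m, (N + 1) * (y + 1) = m + 1 :=
        Nat.exists_eq_succ_of_ne_zero (by positivity)
      simp only [hm] at h
      exact hu δ () _ h

/-- The ground case for `θσ` gives an answer `Qη` and a `δ` with `ηδ = θσ` on the variables of `Q`;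
generalizing the values of `σ` back to variables turns this into `ηδ' = θ`. Since `δ` is known only
after `σ` is chosen, `exists_grounding` treats all `δ` at once. -/
theorem sldnfSemiCompleteFor_of_extended (hconst : Nonempty (L.Functions 0)) {P : Program L}
    {D : Atom L → Prop} {S : Spec L} (hcorrect : CorrectKS P S) {Q : Query L}
    (hext : Extended P Q) : SLDNFSemiCompleteFor P D S Q := by
  refine fun T hT => ⟨fun θ hsat => ?_, failed_of_satNot hcorrect hconst hT⟩
  obtain ⟨σ, hinj, hground, hθ, hη⟩ := exists_grounding hconst hext hT.1 θ
  have hsat' := sat_applyQ hsat σ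
  rw [applyQ_applyQ] at hsat'
  obtain ⟨η, δ, hans, hδ⟩ := exists_answer_of_ground hconst hcorrect hT
    (fun x _ y hy => (mem_varFinset_subst _ _).1 hy |>.elim fun z hz => hground z y hz.2) hsat'
  obtain ⟨δ', hδ'⟩ := exists_generalization hinj
    (fun x y h => hground x y (h ▸ mem_varFinset_var.2 rfl)) δ
  refine ⟨_, hans, δ', ?_⟩
  rw [applyQ_applyQ]
  exact applyQ_congr fun x hx => (hδ' _ _ (hθ x hx) (hη η hans x hx δ) (hδ x hx)).symm

end LP

theorem mainTheorem1 (L : FirstOrder.Language.{u, v}) (hconst : Nonempty (L.Functions 0))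
    (P : LP.Program L) (D : LP.Atom L → Prop) (S : LP.Spec L) (hcorrect : LP.CorrectKS P S) :
    (∀ Q : LP.Query L, LP.Extended P Q → LP.SLDNFSemiCompleteFor P D S Q) ∧
    (∀ Q : LP.Query L, LP.Extended P Q → LP.SemiCompleteKSFor P D S Q) ∧
    (∀ Q : LP.Query L, LP.GroundSLDNFSemiCompleteFor P D S Q) ∧
    (∀ Q : LP.Query L, LP.IsGround Q → LP.SLDNFSemiCompleteFor P D S Q) := by
  have hext := fun Q => LP.sldnfSemiCompleteFor_of_extended (D := D) (Q := Q) hconst hcorrect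
  have hground := LP.groundSLDNFSemiCompleteFor (D := D) hconst hcorrect
  refine ⟨hext, fun Q hQ => LP.semiCompleteKSFor (hext Q hQ), hground, fun Q hQ T hT => ?_⟩
  refine ⟨fun θ => (hground Q T hT).1 θ fun y hy => ?_, (hground Q T hT).2⟩
  obtain ⟨x, hx, _⟩ := LP.varInQuery_applyQ.1 hy
  exact hQ x hx
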